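/- Let $L$ be a relational first-order language, let $T$ be an NIP $L$-theory, let $M\models T$, and let $D\subseteq M$ be a set definable in $M$ with parameters from a set $A\subseteq M$ (for instance $A=\emptyset$). Definability, formulas and induced structure below are understood over $A$, i.e. the elements of $A$ are named by constants. Conventions. A structure $N$ is NIP if for every formula $\varphi(x;y)$ without parameters ($x,y$ finite tuples of variables) there is $n$ such that there are no tuples $(a_i)_{i<n}$, $(b_S)_{S\subseteq n}$ in $N$ with $N\models\varphi(a_i;b_S)\iff i\in S$; a theory is NIP if all its models are. In a structure $N\supseteq D$ in which $D$ is $A$-definable, $D$ is stably embedded if for every formula $\varphi(x;y)$ over $A$ ($x,y$ finite tuples of variables) there is a formula $d\varphi(z;y)$ over $A$ such that for every tuple $a\in N^{|x|}$ there is a tuple $b\in D^{|z|}$ with $$\{d\in D^{|y|}: N\models\varphi(a;d)\}=\{d\in D^{|y|}: N\models d\varphi(b;d)\}.$$ The induced structure on $D$ is the structure with universe $D$ having, for every $n$ and every formula $\theta(x_1,\dots,x_n)$ over $A$, an $n$-ary relation symbol interpreted as $\{d\in D^n: N\models\theta(d)\}$. Assume that $D$ is stably embedded in $M$. Let $D_{ind}$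 be the induced structure on $D$ coming from $M$, let $D'$ be an expansion of $D_{ind}$ to a relational language $L_p$, and let $M'$ be the corresponding expansion of $M$ to the language $L'=L\cup L_p$ (disjoint union), in which an $L_p$-relation holds of a tuple if and only if all its entries lie in $D$ and it holds of the tuple in $D'$. Then: 1. $D$ is stably embedded in $M'$. 2. The structure induced on $D$ by $M'$ is exactly $D'$: for every $n$, a set $S\subseteq D^n$ is of the form $X\cap D^n$ with $X\subseteq M^n$ definable over $A$ in $M'$ if and only if $S$ is definable without parameters in $D'$. 3. If $D'$ is NIP, then so is $M'$. -/

import Mathlib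

open FirstOrder

universe u v u' v' w

namespace FirstOrder.Language



/-- A structure is NIP if no formula `φ(x; y)` has the independence property: there is a bound `n`
such that no `n` tuples `a₀, …, aₙ₋₁` are shattered by the instances `φ(x; b)`. This depends only on
the complete theory of the structure; by compactness, failure of it means that in some elementary
extension there are `(aᵢ)_{i < ω}` and `(b_S)_{S ⊆ ω}` with `φ(aᵢ; b_S)` iff `i ∈ S`. -/
def IsNIPStructure (L : Language.{u, v}) (M : Type w) [L.Structure M] : Prop :=
  ∀ (k l : ℕ) (φ : L.Formula (Fin k ⊕ Fin l)), ∃ n : ℕ,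
    ¬ ∃ (a : Fin n → Fin k → M) (b : Set (Fin n) → Fin l → M),
      ∀ (i : Fin n) (S : Set (Fin n)), φ.Realize (Sum.elim (a i) (b S)) ↔ i ∈ S

/-- A theory (not necessarily complete) is NIP if all of its models are. Since being NIP depends
only on the complete theory of a structure, it is enough to look at models in a universe that
contains the language. -/
def Theory.IsNIP {L : Language.{u, v}} (T : L.Theory) : Prop :=
  ∀ N : Theory.ModelType.{u, v, max u v} T, L.IsNIPStructure N

/-- A subset `D` of `M` (to be used for `∅`-definable `D`) is stably embedded if for every formula
`φ(x; y)` there is a formula `ψ(z; y)` such that for every tuple `a` of `M` there is a tuple `b`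
of `D` with `φ(a; D) = ψ(b; D)`. As `ψ` does not depend on `a`, this holds in `M` iff it holds in
a monster model of the theory of `M`. -/
def StablyEmbedded (L : Language.{u, v}) {M : Type w} [L.Structure M] (D : Set M) : Prop :=
  ∀ (m n : ℕ) (φ : L.Formula (Fin m ⊕ Fin n)),
    ∃ (k : ℕ) (ψ : L.Formula (Fin k ⊕ Fin n)), ∀ a : Fin m → M,
      ∃ b : Fin k → M, (∀ i, b i ∈ D) ∧
        ∀ d : Fin n → M, (∀ i, d i ∈ D) →
          (φ.Realize (Sum.elim a d) ↔ ψ.Realize (Sum.elim b d))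

/-- The relational language with an `n`-ary relation symbol for each `L`-formula in `n` free
variables. -/
def inducedLanguage (L : Language.{u, v}) : Language.{0, max u v} where
  Functions _ := Empty
  Relations n := L.Formula (Fin n)

/-- The structure induced on a subset `D` of `M`: the symbol of an `L`-formula is interpreted by
the trace on `D` of the set that the formula defines in `M`. -/
instance inducedStructure (L : Language.{u, v}) {M : Type w} [L.Structure M] (D : Set M) :
    L.inducedLanguage.Structure D where
  funMap f _ := f.elim
  RelMap φ v := Formula.Realize (M := M) φ (fun i => (v i : M))

/-- A structure on a subset `D` of `M` in a relational language, seen as a structure on `M`: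
a relation holds of a tuple iff all entries of the tuple are in `D` and it holds there. -/
@[reducible]
def extendStructure (Lp : Language.{u', v'}) [Lp.IsRelational] {M : Type w} (D : Set M)
    [Lp.Structure D] : Lp.Structure M where
  funMap f _ := isEmptyElim f
  RelMap R v := ∃ h : ∀ i, v i ∈ D, Structure.RelMap R (fun i => (⟨v i, h i⟩ : D))

end FirstOrder.Language

-- Stable embeddedness confines the effect of the new structure to D. Every set definable in M' has
-- the form {v : ∃ z ∈ D^k, (v, z) ∈ X and z ∈ Θ}, with X definable in M and Θ definable in D'
-- (`DefinableThrough`). Only negation is delicate: X_v ∩ D^k equals Y_b ∩ D^k for some b in D, and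
-- "Y_b misses Θ" is a condition on b definable in D'. Stable embeddedness of D in M' and the
-- description of the induced structure are read off from this form.
--
-- For NIP, let φ(x; y) have this form. Its truth depends on y only through the section X_{xy} ∩
-- D^k, which has a code in D. Equality of the sections at x for y and y', written E_x(y, y'), is
-- definable in M, hence NIP. For fixed points xs, the relation "some y has codes ws at xs and
-- satisfies φ(x; y)" between x and ws reduces to a relation of D', so it is NIP uniformly in xs.
--
-- `isNIPRel_of_code` concludes by finite combinatorics. If φ shatters many points, Ramsey's theorem
-- arranges some of them in blocks such that no y' that is E-equivalent to y at the last point of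
-- every block is inequivalent to y somewhere in each block. By Sauer–Shelah, every block has a
-- subset that no such relation traces with parameters xs among the chosen points. For a y cutting
-- out these subsets, a maximality argument finds boundedly many codes that determine φ on a whole
-- block, a contradiction.

universe u₁

/-! ### Finite combinatorics: Ramsey, alternation, counting of traces. -/

/-- Ramsey's theorem for two-colourings of the `r`-element subsets of a finite set. -/
theorem Finset.exists_monochromatic_subset (r : ℕ) : ∀ p q : ℕ, ∃ N : ℕ,
    ∀ {κ : Type} [DecidableEq κ] (A : Finset κ) (c : Finset κ → Prop), N ≤ A.card →
      ∃ B ⊆ A, (B.card = p ∧ ∀ s ⊆ B, s.card = r → c s) ∨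
        (B.card = q ∧ ∀ s ⊆ B, s.card = r → ¬ c s) := by
  induction r with
  | zero =>
    intro p q
    refine ⟨max p q, fun {κ} _ A c hA => ?_⟩
    by_cases hc : c ∅
    · obtain ⟨B, hB, hBc⟩ := Finset.exists_subset_card_eq (le_trans (le_max_left p q) hA)
      refine ⟨B, hB, Or.inl ⟨hBc, fun s _ hs => ?_⟩⟩
      rwa [Finset.card_eq_zero.1 hs]
    · obtain ⟨B, hB, hBc⟩ := Finset.exists_subset_card_eq (le_trans (le_max_right p q) hA)
      refine ⟨B, hB, Or.inr ⟨hBc, fun s _ hs => ?_⟩⟩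
      rwa [Finset.card_eq_zero.1 hs]
  | succ r ihr =>
    have hempty : ∀ {κ : Type} (s : Finset κ), s ⊆ ∅ → s.card = r + 1 → False := by
      intro κ s hs hc
      rw [Finset.subset_empty.1 hs] at hc
      simp at hc
    have hins : ∀ {κ : Type} [DecidableEq κ] (x : κ) (B B' : Finset κ) (c : Finset κ → Prop),
        x ∉ B' → B ⊆ B' → (∀ s ⊆ B', s.card = r → c (insert x s)) →
        (∀ s ⊆ B, s.card = r + 1 → c s) → ∀ s ⊆ insert x B, s.card = r + 1 → c s := by
      intro κ _ x B B' c hx hBB h1 h2 s hs hsc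
      by_cases hxs : x ∈ s
      · rw [← Finset.insert_erase hxs]
        refine h1 _ (fun y hy => ?_) (by rw [Finset.card_erase_of_mem hxs, hsc]; rfl)
        obtain ⟨hyx, hys⟩ := Finset.mem_erase.1 hy
        exact hBB ((Finset.mem_insert.1 (hs hys)).resolve_left hyx)
      · refine h2 s (fun y hy => ?_) hsc
        rcases Finset.mem_insert.1 (hs hy) with rfl | h4
        · exact absurd hy hxs
        · exact h4
    intro p
    induction p with
    | zero =>
      intro q
      exact ⟨0, fun A c _ => ⟨∅, Finset.empty_subset _,
        Or.inl ⟨rfl, fun s hs hc => (hempty s hs hc).elim⟩⟩⟩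
    | succ p ihp =>
      intro q
      induction q with
      | zero =>
        exact ⟨0, fun A c _ => ⟨∅, Finset.empty_subset _,
          Or.inr ⟨rfl, fun s hs hc => (hempty s hs hc).elim⟩⟩⟩
      | succ q ihq =>
        obtain ⟨N₁, h₁⟩ := ihp (q + 1)
        obtain ⟨N₂, h₂⟩ := ihq
        obtain ⟨N, hN⟩ := ihr N₁ N₂
        refine ⟨N + 1, fun {κ} _ A c hA => ?_⟩
        obtain ⟨x, hx⟩ : A.Nonempty := Finset.card_pos.1 (by omega)
        -- The colour of an (r+1)-set containing x is a colouring of r-sets; B' is homogeneous for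
        -- it.
        obtain ⟨B', hB', h⟩ := hN (A.erase x) (fun s => c (insert x s))
          (by rw [Finset.card_erase_of_mem hx]; omega)
        have hxB' : x ∉ B' := fun h => by simpa using hB' h
        have hB'A : B' ⊆ A := hB'.trans (Finset.erase_subset _ _)
        rcases h with ⟨hc, hs⟩ | ⟨hc, hs⟩
        · obtain ⟨B, hB, h | h⟩ := h₁ B' c hc.ge
          · refine ⟨insert x B, Finset.insert_subset hx (hB.trans hB'A), Or.inl ⟨?_, ?_⟩⟩
            · rw [Finset.card_insert_of_notMem fun h => hxB' (hB h), h.1]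
            · exact hins x B B' c hxB' hB hs h.2
          · exact ⟨B, hB.trans hB'A, Or.inr h⟩
        · obtain ⟨B, hB, h | h⟩ := h₂ B' c hc.ge
          · exact ⟨B, hB.trans hB'A, Or.inl h⟩
          · refine ⟨insert x B, Finset.insert_subset hx (hB.trans hB'A), Or.inr ⟨?_, ?_⟩⟩
            · rw [Finset.card_insert_of_notMem fun h => hxB' (hB h), h.1]
            · exact hins x B B' (fun s => ¬ c s) hxB' hB hs h.2

namespace FirstOrder.Language

/-- `R` shatters some family of `n` points. -/
def ShattersFamily {X Y : Type*} (R : X → Y → Prop) (n : ℕ) : Prop :=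
  ∃ (a : Fin n → X) (b : Set (Fin n) → Y), ∀ (i : Fin n) (S : Set (Fin n)), R (a i) (b S) ↔ i ∈ S

/-- A relation has the non-independence property. -/
def IsNIPRel {X Y : Type*} (R : X → Y → Prop) : Prop :=
  ∃ n : ℕ, ¬ ShattersFamily R n

/-- Colour a 2h-set by whether some z alternates along it, with R holding exactly at the odd
positions. A homogeneous set of 3h points with alternation would make R shatter h points. So there
is one without alternation, which is cut into h consecutive blocks of l + 1 points; the excluded
pattern would be an alternation along two points from each block. -/
theorem exists_alternationFree_block {X Z : Type*} {R : X → Z → Prop} {h : ℕ}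
    (hR : ¬ ShattersFamily R h) (l : ℕ) :
    ∃ N : ℕ, ∀ a : Fin N → X, ∃ e : Fin h × Fin (l + 1) → Fin N, Function.Injective e ∧
      ∀ (z : Z) (p : Fin h → Fin l),
        ¬ ∀ s, ¬ R (a (e (s, (p s).castSucc))) z ∧ R (a (e (s, Fin.last l))) z := by
  obtain ⟨N, hN⟩ := Finset.exists_monochromatic_subset (2 * h) (3 * h) (h * (l + 1))
  refine ⟨N, fun a => ?_⟩
  obtain ⟨B, -, ⟨hBc, hB⟩ | ⟨hBc, hB⟩⟩ := hN (Finset.univ : Finset (Fin N))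
    (fun s => ∃ z, ∀ (hs : s.card = 2 * h) (j : Fin (2 * h)),
      R (a (s.orderEmbOfFin hs j)) z ↔ Odd (j : ℕ)) (by simp)
  · exfalso
    have key : ∀ t : Fin (2 * h) → Fin (3 * h), StrictMono t →
        ∃ z, ∀ j, R (a (B.orderEmbOfFin hBc (t j))) z ↔ Odd (j : ℕ) := by
      intro t ht
      have hm : StrictMono fun j => B.orderEmbOfFin hBc (t j) :=
        (B.orderEmbOfFin hBc).strictMono.comp ht
      have hcard : (Finset.univ.image fun j => B.orderEmbOfFin hBc (t j)).card = 2 * h := by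
        rw [Finset.card_image_of_injective _ hm.injective, Finset.card_univ, Fintype.card_fin]
      obtain ⟨z, hz⟩ := hB (Finset.univ.image fun j => B.orderEmbOfFin hBc (t j)) (by
        intro x hx
        obtain ⟨j, -, rfl⟩ := Finset.mem_image.1 hx
        exact Finset.orderEmbOfFin_mem _ _ _) hcard
      refine ⟨z, fun j => ?_⟩
      rw [← hz hcard j, ← Finset.orderEmbOfFin_unique hcard (fun x => by simp) hm]
    classical
    -- From the i-th triple take 3i, 3i+1 if i ∈ S and 3i+1, 3i+2 otherwise: the middle point 3i+1
    -- gets an odd position exactly when i ∈ S.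
    let t : Set (Fin h) → Fin (2 * h) → Fin (3 * h) := fun S j =>
      ⟨3 * (j / 2) + j % 2 + if (⟨j / 2, by omega⟩ : Fin h) ∈ S then 0 else 1, by
        split_ifs <;> omega⟩
    have ht : ∀ S, StrictMono (t S) := by
      intro S i j hij
      rw [Fin.lt_def] at hij ⊢
      simp only [t]
      by_cases hd : (i : ℕ) / 2 = j / 2
      · simp only [hd]
        omega
      · split_ifs <;> omega
    choose b hb using fun S => key (t S) (ht S)
    refine hR ⟨fun i => a (B.orderEmbOfFin hBc ⟨3 * i + 1, by omega⟩), b, fun i S => ?_⟩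
    by_cases hi : i ∈ S
    · have h1 := hb S ⟨2 * i + 1, by omega⟩
      have h2 : t S ⟨2 * i + 1, by omega⟩ = ⟨3 * i + 1, by omega⟩ := by
        have h3 : (2 * (i : ℕ) + 1) / 2 = i := by omega
        simp only [t, h3, Fin.eta, hi, if_true, Fin.mk.injEq]
        omega
      rw [h2] at h1
      rw [h1]
      simp [hi]
    · have h1 := hb S ⟨2 * i, by omega⟩
      have h2 : t S ⟨2 * i, by omega⟩ = ⟨3 * i + 1, by omega⟩ := by
        have h3 : (2 * (i : ℕ)) / 2 = i := by omega
        simp only [t, h3, Fin.eta, hi, if_false, Fin.mk.injEq]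
        omega
      rw [h2] at h1
      rw [h1]
      simp [hi]
  -- `finProdFinEquiv` is lexicographic, so blocks are intervals and `Fin.last l` comes at the end
  -- of each.
  · refine ⟨fun x => B.orderEmbOfFin hBc (finProdFinEquiv x),
      (B.orderEmbOfFin hBc).injective.comp finProdFinEquiv.injective, fun z p hz => ?_⟩
    let t : Fin (2 * h) → Fin h × Fin (l + 1) := fun j =>
      (⟨j / 2, by omega⟩,
        if (j : ℕ) % 2 = 0 then (p ⟨j / 2, by omega⟩).castSucc else Fin.last l)
    have ht : StrictMono fun j => finProdFinEquiv (t j) := by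
      intro i j hij
      rw [Fin.lt_def] at hij ⊢
      simp only [t, finProdFinEquiv_apply_val]
      by_cases hd : (i : ℕ) / 2 = j / 2
      · have hi : (i : ℕ) % 2 = 0 := by omega
        have hj : ¬ (j : ℕ) % 2 = 0 := by omega
        simp only [hi, hj, hd, if_true, if_false, Fin.val_last, Fin.val_castSucc]
        have := (p ⟨j / 2, by omega⟩).2
        omega
      · have h1 : (i : ℕ) / 2 + 1 ≤ j / 2 := by omega
        have h2 := Nat.mul_le_mul_left (l + 1) h1
        have h3 : ∀ y : Fin (l + 1), (y : ℕ) < l + 1 := fun y => y.2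
        refine lt_of_lt_of_le (Nat.add_lt_add_right (h3 _) _) (le_trans ?_ (Nat.le_add_left _ _))
        rw [mul_add] at h2
        omega
    have hm : StrictMono fun j => B.orderEmbOfFin hBc (finProdFinEquiv (t j)) :=
      (B.orderEmbOfFin hBc).strictMono.comp ht
    have hcard : (Finset.univ.image
        fun j => B.orderEmbOfFin hBc (finProdFinEquiv (t j))).card = 2 * h := by
      rw [Finset.card_image_of_injective _ hm.injective, Finset.card_univ, Fintype.card_fin]
    refine hB (Finset.univ.image fun j => B.orderEmbOfFin hBc (finProdFinEquiv (t j))) (by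
      intro x hx
      obtain ⟨j, -, rfl⟩ := Finset.mem_image.1 hx
      exact Finset.orderEmbOfFin_mem _ _ _) hcard ⟨z, fun hs j => ?_⟩
    rw [← Finset.orderEmbOfFin_unique hs (fun x => by simp) hm]
    have h1 := hz (t j).1
    by_cases hj : (j : ℕ) % 2 = 0
    · have h2 : t j = ((t j).1, (p (t j).1).castSucc) := by
        simp only [t, hj, if_true]
      beta_reduce
      rw [h2]
      exact iff_of_false h1.1 (by rw [Nat.odd_iff]; omega)
    · have h2 : t j = ((t j).1, Fin.last l) := by
        simp only [t, hj, if_false]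
      beta_reduce
      rw [h2]
      exact iff_of_true h1.2 (by rw [Nat.odd_iff]; omega)

open Classical in
/-- A polynomial bound for the number of traces of a relation that does not shatter `v` points. -/
theorem card_traces_le {X W : Type*} {Q : X → W → Prop} {v : ℕ} (hQ : ¬ ShattersFamily Q v)
    {l : ℕ} (x : Fin l → X) :
    (Finset.univ.filter fun T : Finset (Fin l) => ∃ w, ∀ i, i ∈ T ↔ Q (x i) w).card ≤
      (v + 1) * (l + 1) ^ v := by
  set F := Finset.univ.filter fun T : Finset (Fin l) => ∃ w, ∀ i, i ∈ T ↔ Q (x i) w with hF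
  have hdim : F.vcDim ≤ v := by
    refine Finset.sup_le fun s hs => ?_
    rw [Finset.mem_shatterer] at hs
    by_contra! hlt
    obtain ⟨s', hs', hcard⟩ := Finset.exists_subset_card_eq hlt.le
    have hsh := hs.mono_right hs'
    let f := s'.equivFinOfCardEq hcard
    have : ∀ S : Set (Fin v), ∃ w, ∀ i, Q (x (f.symm i)) w ↔ i ∈ S := by
      intro S
      obtain ⟨T, hT, hST⟩ := @hsh (s'.filter fun i => ∃ h : i ∈ s', f ⟨i, h⟩ ∈ S)
        (Finset.filter_subset _ _)
      obtain ⟨w, hw⟩ := (Finset.mem_filter.1 hT).2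
      refine ⟨w, fun i => ?_⟩
      have h1 : ((f.symm i : s') : Fin l) ∈ s' ∩ T ↔ i ∈ S := by
        rw [hST]
        simp
      rw [← hw, ← h1]
      simp
    choose b hb using this
    exact hQ ⟨fun i => x (f.symm i), b, fun i S => hb S i⟩
  calc F.card ≤ F.shatterer.card := Finset.card_le_card_shatterer F
    _ ≤ ∑ k ∈ Finset.Iic F.vcDim, (Fintype.card (Fin l)).choose k :=
      Finset.card_shatterer_le_sum_vcDim
    _ ≤ ∑ k ∈ Finset.Iic v, (Fintype.card (Fin l)).choose k :=
      Finset.sum_le_sum_of_subset (Finset.Iic_subset_Iic.2 hdim)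
    _ ≤ ∑ k ∈ Finset.Iic v, (l + 1) ^ v := by
      refine Finset.sum_le_sum fun k hk => ?_
      rw [Fintype.card_fin]
      calc l.choose k ≤ l ^ k := Nat.choose_le_pow l k
        _ ≤ (l + 1) ^ k := Nat.pow_le_pow_left (Nat.le_succ l) k
        _ ≤ (l + 1) ^ v := Nat.pow_le_pow_right (Nat.succ_pos l) (Finset.mem_Iic.1 hk)
    _ = (v + 1) * (l + 1) ^ v := by simp

theorem exists_mul_pow_lt_two_pow (C d : ℕ) : ∃ l : ℕ, C * (l + 1) ^ d < 2 ^ l := by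
  have h := tendsto_pow_const_div_const_pow_of_one_lt d (one_lt_two (α := ℝ))
  -- The shift by one yields 2 ^ (l + 1) in the denominator, whence the factor 2 in front of C.
  have h' := (h.comp (Filter.tendsto_add_atTop_nat 1)).const_mul (2 * C : ℝ)
  rw [mul_zero] at h'
  obtain ⟨l, hl⟩ := (h'.eventually (gt_mem_nhds (one_pos : (0 : ℝ) < 1))).exists
  refine ⟨l, ?_⟩
  have h2 : (0 : ℝ) < 2 ^ (l + 1) := by positivity
  simp only [Function.comp_apply] at hl
  rw [← mul_div_assoc, div_lt_one h2] at hl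
  push_cast at hl
  have h3 : (C : ℝ) * ((l : ℝ) + 1) ^ d < 2 ^ l := by
    rw [pow_succ] at hl
    linarith
  exact_mod_cast h3

/-! ### The coding criterion for NIP. -/

/-- Suppose that the truth value of `φ x y` depends only on the class of `y` for an equivalence
relation `E x` which is NIP, and that these classes have codes. If, for every finite tuple of points,
the relation saying that `φ x y` holds for some `y` with prescribed codes at these points is NIP,
then `φ` is NIP. -/
theorem isNIPRel_of_code {X Y W : Type*} {φ : X → Y → Prop} {E : X → Y → Y → Prop}
    {Code : X → Y → W → Prop}
    (hφ : ∀ x y y', E x y y' → (φ x y ↔ φ x y'))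
    (hcode : ∀ x y, ∃ w, Code x y w)
    (hE : ∀ x y y' w, Code x y w → (Code x y' w ↔ E x y y'))
    (hENIP : IsNIPRel fun (x : X) (p : Y × Y) => E x p.1 p.2)
    (hρ : ∀ q : ℕ, ∃ v, ∀ xs : Fin q → X,
      ¬ ShattersFamily (fun x (ws : Fin q → W) => ∃ y, (∀ j, Code (xs j) y (ws j)) ∧ φ x y) v) :
    IsNIPRel φ := by
  classical
  have hrefl : ∀ x y, E x y y := fun x y => by
    obtain ⟨w, hw⟩ := hcode x y
    exact (hE x y y w hw).1 hw
  have hsymm : ∀ {x y y'}, E x y y' → E x y' y := fun {x y y'} h => by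
    obtain ⟨w, hw⟩ := hcode x y
    exact (hE x y' y w ((hE x y y' w hw).2 h)).1 hw
  have htrans : ∀ {x y y' y''}, E x y y' → E x y' y'' → E x y y'' := fun {x y y' y''} h h' => by
    obtain ⟨w, hw⟩ := hcode x y
    exact (hE x y y'' w hw).1 ((hE x y' y'' w ((hE x y y' w hw).2 h)).2 h')
  obtain ⟨h, hh⟩ := hENIP
  obtain ⟨v, hv⟩ := hρ (h + h)
  -- There are (h(l+1))^(2h) tuples xs of block points, each giving at most (v+1)(l+1)^v traces;
  -- their product has to stay below the number 2^l of subsets of a block without its last point.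
  obtain ⟨l, hl⟩ := exists_mul_pow_lt_two_pow (h ^ (h + h) * (v + 1)) (h + h + v)
  obtain ⟨N, hN⟩ := exists_alternationFree_block hh l
  refine ⟨N, ?_⟩
  rintro ⟨a, b, hab⟩
  obtain ⟨e, he, hne⟩ := hN a
  let ρ : (Fin (h + h) → Fin h × Fin (l + 1)) → X → (Fin (h + h) → W) → Prop := fun xs x ws =>
    ∃ y, (∀ j, Code (a (e (xs j))) y (ws j)) ∧ φ x y
  have hT : ∀ s : Fin h, ∃ T : Finset (Fin l), ∀ xs ws,
      ¬ ∀ i, i ∈ T ↔ ρ xs (a (e (s, i.castSucc))) ws := by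
    intro s
    by_contra! hcon
    let F : (Fin (h + h) → Fin h × Fin (l + 1)) → Finset (Finset (Fin l)) := fun xs =>
      Finset.univ.filter fun T => ∃ w, ∀ i, i ∈ T ↔ ρ xs (a (e (s, i.castSucc))) w
    have hF : ∀ xs, (F xs).card ≤ (v + 1) * (l + 1) ^ v := fun xs =>
      card_traces_le (hv fun j => a (e (xs j))) fun i => a (e (s, i.castSucc))
    have huniv : (Finset.univ : Finset (Finset (Fin l))) ⊆ Finset.univ.biUnion F := by
      intro T _
      obtain ⟨xs, ws, hT⟩ := hcon T
      exact Finset.mem_biUnion.2 ⟨xs, Finset.mem_univ _,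
        Finset.mem_filter.2 ⟨Finset.mem_univ _, ws, hT⟩⟩
    have h1 := (Finset.card_le_card huniv).trans (Finset.card_biUnion_le_card_mul _ _ _
      fun xs _ => hF xs)
    simp only [Finset.card_univ, Fintype.card_finset, Fintype.card_fin, Fintype.card_fun,
      Fintype.card_prod] at h1
    refine absurd h1 (not_le.2 (lt_of_eq_of_lt ?_ hl))
    rw [mul_pow, pow_add (l + 1) (h + h) v]
    ring
  choose T hT using hT
  -- b S cuts out the untraceable subset T s in all blocks simultaneously.
  let S : Set (Fin N) := {n | ∃ s, ∃ i ∈ T s, n = e (s, i.castSucc)}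
  have hS : ∀ s i, φ (a (e (s, i.castSucc))) (b S) ↔ i ∈ T s := by
    intro s i
    rw [hab]
    constructor
    · rintro ⟨s', i', hi', heq⟩
      have := he heq
      simp only [Prod.mk.injEq, Fin.castSucc_inj] at this
      obtain ⟨rfl, rfl⟩ := this
      exact hi'
    · exact fun hi => ⟨s, i, hi, rfl⟩
  -- A block is touched by y if y and b S are inequivalent at some point of it other than the last.
  -- No y in 𝒴 touches all h blocks, by the choice of e; a y in 𝒴 touching as many as possible is
  -- taken.
  let touched : Y → Finset (Fin h) := fun y =>
    Finset.univ.filter fun s => ∃ i : Fin l, ¬ E (a (e (s, i.castSucc))) (b S) y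
  let 𝒴 : Set Y := {y | ∀ s, E (a (e (s, Fin.last l))) (b S) y}
  obtain ⟨y, hy, hmax⟩ := (measure fun y => h - (touched y).card).wf.has_min 𝒴
    ⟨b S, fun s => hrefl _ _⟩
  have hmax' : ∀ y' ∈ 𝒴, (touched y').card ≤ (touched y).card := by
    intro y' hy'
    have h1 := hmax y' hy'
    have h2 : (touched y').card ≤ h := (Finset.card_le_univ _).trans (by simp)
    have h3 : ¬ (h - (touched y').card < h - (touched y).card) := h1
    omega
  obtain ⟨s₀, hs₀⟩ : ∃ s₀, s₀ ∉ touched y := by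
    by_contra! hall
    have : ∀ s, ∃ i : Fin l, ¬ E (a (e (s, i.castSucc))) (b S) y := fun s =>
      (Finset.mem_filter.1 (hall s)).2
    choose p hp using this
    exact hne (b S, y) p fun s => ⟨hp s, hy s⟩
  have : ∀ s, ∃ p : Fin (l + 1), s ∈ touched y → ¬ E (a (e (s, p))) (b S) y := by
    intro s
    by_cases hs : s ∈ touched y
    · obtain ⟨i, hi⟩ := (Finset.mem_filter.1 hs).2
      exact ⟨i.castSucc, fun _ => hi⟩
    · exact ⟨0, fun h => absurd h hs⟩
  choose p hp using this
  choose w hw using fun x => hcode x y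
  let xs : Fin (h + h) → Fin h × Fin (l + 1) :=
    Fin.append (fun s => (s, Fin.last l)) fun s => (s, p s)
  have hunt : ∀ y', s₀ ∉ touched y' → ∀ i : Fin l, E (a (e (s₀, i.castSucc))) (b S) y' := by
    intro y' hy' i
    by_contra hcon
    exact hy' (Finset.mem_filter.2 ⟨Finset.mem_univ _, i, hcon⟩)
  -- The codes of y at xs pin down enough: any y' sharing them stays in 𝒴 and touches every block
  -- that y touches, hence by maximality no other. So y' agrees with b S on block s₀, and T s₀ is
  -- traced after all.
  refine hT s₀ xs (fun j => w (a (e (xs j)))) fun i => ?_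
  rw [← hS]
  constructor
  · intro hi
    exact ⟨y, fun j => hw _, (hφ _ _ _ (hunt y hs₀ i)).1 hi⟩
  · rintro ⟨y', hy', hi⟩
    have hEy : ∀ j, E (a (e (xs j))) y y' := fun j => (hE _ _ _ _ (hw _)).1 (hy' j)
    have h1 : y' ∈ 𝒴 := by
      intro s
      have := hEy (Fin.castAdd h s)
      simp only [xs, Fin.append_left] at this
      exact htrans (hy s) this
    have h2 : touched y ⊆ touched y' := by
      intro s hs
      have hE' := hEy (Fin.natAdd h s)
      simp only [xs, Fin.append_right] at hE'
      have h3 : ¬ E (a (e (s, p s))) (b S) y' := fun h4 => hp s hs (htrans h4 (hsymm hE'))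
      refine Finset.mem_filter.2 ⟨Finset.mem_univ _, ?_⟩
      induction hps : p s using Fin.lastCases with
      | last => exact absurd (hps ▸ h1 s) h3
      | cast i => exact ⟨i, hps ▸ h3⟩
    have h3 : touched y = touched y' := Finset.eq_of_subset_of_card_le h2 (hmax' y' h1)
    exact (hφ _ _ _ (hunt y' (h3 ▸ hs₀) i)).2 hi

end FirstOrder.Language

/-! ### Closure properties of definable sets. -/

namespace Set.Definable

open FirstOrder.Language

variable {L : FirstOrder.Language.{u, v}} {M : Type w} [L.Structure M] {A : Set M}
variable {α β γ : Type*}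

theorem and {p q : (α → M) → Prop} (hp : A.Definable L {v | p v}) (hq : A.Definable L {v | q v}) :
    A.Definable L {v | p v ∧ q v} :=
  hp.inter hq

theorem not {p : (α → M) → Prop} (hp : A.Definable L {v | p v}) : A.Definable L {v | ¬ p v} :=
  hp.compl

theorem imp {p q : (α → M) → Prop} (hp : A.Definable L {v | p v}) (hq : A.Definable L {v | q v}) :
    A.Definable L {v | p v → q v} := by
  convert! hp.not.union hq using 1
  ext v
  exact imp_iff_not_or

theorem iff {p q : (α → M) → Prop} (hp : A.Definable L {v | p v}) (hq : A.Definable L {v | q v}) :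
    A.Definable L {v | p v ↔ q v} := by
  convert! (hp.imp hq).and (hq.imp hp) using 1
  ext v
  exact iff_def

theorem ex [Finite β] {p : (α → M) → (β → M) → Prop}
    (hp : A.Definable L {w : α ⊕ β → M | p (w ∘ Sum.inl) (w ∘ Sum.inr)}) :
    A.Definable L {v | ∃ u, p v u} :=
  hp.exists_of_finite

theorem all [Finite β] {p : (α → M) → (β → M) → Prop}
    (hp : A.Definable L {w : α ⊕ β → M | p (w ∘ Sum.inl) (w ∘ Sum.inr)}) :
    A.Definable L {v | ∀ u, p v u} :=
  hp.forall_of_finite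

theorem forall_finite {ι : Type*} [Finite ι] {p : ι → (α → M) → Prop}
    (hp : ∀ i, A.Definable L {v | p i v}) : A.Definable L {v | ∀ i, p i v} := by
  convert! definable_iInter_of_finite hp using 1
  ext v
  simp

theorem comp {S : Set (β → M)} (hS : A.Definable L S) (f : β → α) :
    A.Definable L {v : α → M | (fun i => v (f i)) ∈ S} :=
  hS.preimage_comp f

theorem sumElim_comp {S : Set (β ⊕ γ → M)} (hS : A.Definable L S) (f : β → α) (g : γ → α) :
    A.Definable L {v : α → M | Sum.elim (fun i => v (f i)) (fun i => v (g i)) ∈ S} := by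
  convert! hS.preimage_comp (Sum.elim f g) using 1
  ext v
  show _ ↔ v ∘ Sum.elim f g ∈ S
  rw [Sum.comp_elim]
  rfl

theorem coord_mem {D : Set M} (hD : A.Definable₁ L D) (i : α) :
    A.Definable L {v : α → M | v i ∈ D} :=
  hD.preimage_comp fun _ : Fin 1 => i

theorem forall_coord_mem {D : Set M} (hD : A.Definable₁ L D) {ι : Type*} [Finite ι] (f : ι → α) :
    A.Definable L {v : α → M | ∀ i, v (f i) ∈ D} :=
  forall_finite fun i => coord_mem hD (f i)

end Set.Definable

/-! ### Stable embeddedness and traces in terms of definable sets. -/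

namespace FirstOrder.Language

open Set Structure

theorem Term.exists_eq_var {L : Language.{u, v}} [L.IsRelational] {α : Type*} (t : L.Term α) :
    ∃ i, t = Term.var i := by
  cases t with
  | var i => exact ⟨i, rfl⟩
  | func f _ => exact isEmptyElim f

variable {L : Language.{u, v}} {M : Type w} [L.Structure M] {A D : Set M}

theorem StablyEmbedded.exists_definable (h : L[[A]].StablyEmbedded D) {α β : Type*} [Finite α]
    [Finite β] {X : Set (α ⊕ β → M)} (hX : A.Definable L X) :
    ∃ (k : ℕ) (Y : Set (Fin k ⊕ β → M)), A.Definable L Y ∧ ∀ a : α → M, ∃ b : Fin k → D,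
      ∀ d : β → D, Sum.elim a (fun i => (d i : M)) ∈ X ↔
        Sum.elim (fun i => (b i : M)) (fun i => (d i : M)) ∈ Y := by
  obtain ⟨m, ⟨e⟩⟩ := Finite.exists_equiv_fin α
  obtain ⟨n, ⟨f⟩⟩ := Finite.exists_equiv_fin β
  obtain ⟨φ, rfl⟩ := hX
  obtain ⟨k, ψ, hψ⟩ := h m n (φ.relabel (Sum.map e f))
  refine ⟨k, {v | ψ.Realize (v ∘ Sum.map id f.symm)}, ⟨ψ.relabel (Sum.map id f.symm), ?_⟩,
    fun a => ?_⟩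
  · ext v
    simp
  · obtain ⟨b, hbD, hb⟩ := hψ (a ∘ e.symm)
    refine ⟨fun i => ⟨b i, hbD i⟩, fun d => ?_⟩
    have := hb (fun i => d (f.symm i)) (fun i => (d _).2)
    rw [Formula.realize_relabel] at this
    have h₁ : Sum.elim (a ∘ e.symm) (fun i => (d (f.symm i) : M)) ∘ Sum.map e f =
        Sum.elim a fun i => (d i : M) := by
      ext i
      rcases i with i | i <;> simp
    have h₂ : Sum.elim (fun i => b i) (fun i => (d i : M)) ∘ Sum.map id f.symm =
        Sum.elim b fun i => (d (f.symm i) : M) := by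
      ext i
      rcases i with i | i <;> simp
    rw [h₁] at this
    rw [← h₂] at this
    exact this

theorem stablyEmbedded_of_definable
    (h : ∀ (m n : ℕ) (X : Set (Fin m ⊕ Fin n → M)), A.Definable L X →
      ∃ (k : ℕ) (Y : Set (Fin k ⊕ Fin n → M)), A.Definable L Y ∧ ∀ a : Fin m → M,
        ∃ b : Fin k → D, ∀ d : Fin n → D, Sum.elim a (fun i => (d i : M)) ∈ X ↔
          Sum.elim (fun i => (b i : M)) (fun i => (d i : M)) ∈ Y) :
    L[[A]].StablyEmbedded D := by
  intro m n φ
  obtain ⟨k, _, ⟨ψ, rfl⟩, hψ⟩ := h m n {v | φ.Realize v} ⟨φ, rfl⟩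
  refine ⟨k, ψ, fun a => ?_⟩
  obtain ⟨b, hb⟩ := hψ a
  exact ⟨fun i => b i, fun i => (b i).2, fun d hd => hb fun i => ⟨d i, hd i⟩⟩

/-- The trace is a basic relation of the induced structure, and ι names it by a symbol of `Lp`. -/
theorem definable_trace {Lp : Language.{u', v'}} [Lp.Structure D]
    (ι : L[[A]].inducedLanguage →ᴸ Lp) (hι : ι.IsExpansionOn D) {α : Type*} [Finite α]
    {X : Set (α → M)} (hX : A.Definable L X) :
    (∅ : Set D).Definable Lp {v : α → D | (fun i => (v i : M)) ∈ X} := by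
  obtain ⟨m, ⟨e⟩⟩ := Finite.exists_equiv_fin α
  obtain ⟨φ, rfl⟩ := hX
  rw [empty_definable_iff]
  refine ⟨(ι.onRelation (φ.relabel e : L[[A]].Formula (Fin m))).formula
    fun i => Term.var (e.symm i), ?_⟩
  ext v
  have h := hι.map_onRelation (φ.relabel e : L[[A]].Formula (Fin m)) fun i => v (e.symm i)
  simp only [Set.mem_ofPred_eq, Formula.realize_rel, Term.realize_var, h]
  show _ ↔ (φ.relabel e).Realize (fun i => (v (e.symm i) : M))
  rw [Formula.realize_relabel]
  simp [Function.comp_def]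

/-! ### Sets definable through D, and quantifier elimination down to D. -/

section Expansion

variable {Lp : Language.{u', v'}} [Lp.Structure D]

/-- Sets of tuples of `M` of the form `∃ z ∈ D, (v, z) ∈ X ∧ z ∈ Θ`, with `X` definable in `M` and
`Θ` definable in a structure on `D`. -/
def DefinableThrough (L : Language.{u, v}) [L.Structure M] (A D : Set M) (Lp : Language.{u', v'})
    [Lp.Structure D] {α : Type*} (S : Set (α → M)) : Prop :=
  ∃ (k : ℕ) (X : Set (α ⊕ Fin k → M)) (Θ : Set (Fin k → D)), A.Definable L X ∧
    (∅ : Set D).Definable Lp Θ ∧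
      S = {v | ∃ z : Fin k → D, Sum.elim v (fun i => (z i : M)) ∈ X ∧ z ∈ Θ}

namespace DefinableThrough

variable {α β : Type*}

theorem of_finite {γ : Type*} [Finite γ] {X : Set (α ⊕ γ → M)} {Θ : Set (γ → D)}
    (hX : A.Definable L X) (hΘ : (∅ : Set D).Definable Lp Θ) :
    DefinableThrough L A D Lp {v : α → M | ∃ z : γ → D,
      Sum.elim v (fun i => (z i : M)) ∈ X ∧ z ∈ Θ} := by
  obtain ⟨k, ⟨e⟩⟩ := Finite.exists_equiv_fin γ
  refine ⟨k, _, _, hX.sumElim_comp Sum.inl fun i => Sum.inr (e i), hΘ.comp e, ?_⟩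
  ext v
  constructor
  · rintro ⟨z, h1, h2⟩
    refine ⟨fun i => z (e.symm i), ?_, ?_⟩
    · simpa using h1
    · simpa using h2
  · rintro ⟨z, h1, h2⟩
    exact ⟨fun i => z (e i), h1, h2⟩

theorem of_definable {S : Set (α → M)} (hS : A.Definable L S) : DefinableThrough L A D Lp S := by
  convert! of_finite (γ := Fin 0) (hS.comp Sum.inl) (definable_univ (α := Fin 0)) using 1
  ext v
  simp

theorem inter {S T : Set (α → M)} (hS : DefinableThrough L A D Lp S)
    (hT : DefinableThrough L A D Lp T) : DefinableThrough L A D Lp (S ∩ T) := by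
  obtain ⟨k, X, Θ, hX, hΘ, rfl⟩ := hS
  obtain ⟨k', X', Θ', hX', hΘ', rfl⟩ := hT
  convert! of_finite (γ := Fin k ⊕ Fin k')
    ((hX.sumElim_comp Sum.inl fun i => Sum.inr (Sum.inl i)).and
      (hX'.sumElim_comp Sum.inl fun i => Sum.inr (Sum.inr i)))
    ((hΘ.comp Sum.inl).and (hΘ'.comp Sum.inr)) using 1
  ext v
  constructor
  · rintro ⟨⟨z, h1, h2⟩, z', h1', h2'⟩
    exact ⟨Sum.elim z z', ⟨h1, h1'⟩, h2, h2'⟩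
  · rintro ⟨z, ⟨h1, h1'⟩, h2, h2'⟩
    exact ⟨⟨_, h1, h2⟩, _, h1', h2'⟩

theorem comp {S : Set (β → M)} (hS : DefinableThrough L A D Lp S) (f : β → α) :
    DefinableThrough L A D Lp {v : α → M | (fun i => v (f i)) ∈ S} := by
  obtain ⟨k, X, Θ, hX, hΘ, rfl⟩ := hS
  exact ⟨k, _, Θ, hX.sumElim_comp (fun i => Sum.inl (f i)) Sum.inr, hΘ, rfl⟩

/-- Θ does not involve u, so the quantifier over M passes inside the one over D and is absorbed into
X. -/
theorem ex [Finite β] {S : Set (α ⊕ β → M)} (hS : DefinableThrough L A D Lp S) :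
    DefinableThrough L A D Lp {v : α → M | ∃ u : β → M, Sum.elim v u ∈ S} := by
  obtain ⟨k, X, Θ, hX, hΘ, rfl⟩ := hS
  let p : (α ⊕ Fin k → M) → (β → M) → Prop := fun w u =>
    Sum.elim (Sum.elim (w ∘ Sum.inl) u) (w ∘ Sum.inr) ∈ X
  have hp : A.Definable L {w | ∃ u, p w u} := by
    refine Set.Definable.ex ?_
    convert! hX.comp (Sum.elim (Sum.elim (fun i => Sum.inl (Sum.inl i)) Sum.inr)
      fun i => Sum.inl (Sum.inr i)) using 1
    ext w
    simp only [p, Set.mem_ofPred_eq]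
    refine iff_of_eq (congrArg (· ∈ X) ?_)
    ext i
    rcases i with (i | i) | i <;> rfl
  refine ⟨k, _, Θ, hp, hΘ, ?_⟩
  ext v
  constructor
  · rintro ⟨u, z, h1, h2⟩
    exact ⟨z, ⟨u, h1⟩, h2⟩
  · rintro ⟨z, ⟨u, h1⟩, h2⟩
    exact ⟨u, z, h1, h2⟩

/-- Parameters are treated as extra variables during the induction on formulas; here they get their
values back. -/
theorem subst_params {A₀ : Finset M} (hA₀ : (A₀ : Set M) ⊆ A) [Finite α]
    {S : Set ((A₀ : Set M) ⊕ α → M)} (hS : DefinableThrough L A D Lp S) :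
    DefinableThrough L A D Lp {v : α → M | Sum.elim (fun a : (A₀ : Set M) => (a : M)) v ∈ S} := by
  obtain ⟨k, X, Θ, hX, hΘ, rfl⟩ := hS
  refine ⟨k, {w | Sum.elim (Sum.elim (fun a : (A₀ : Set M) => (a : M)) (w ∘ Sum.inl))
    (w ∘ Sum.inr) ∈ X}, Θ, ?_, hΘ, rfl⟩
  refine Definable.preimage_map (F := fun w : α ⊕ Fin k → M =>
    Sum.elim (Sum.elim (fun a : (A₀ : Set M) => (a : M)) (w ∘ Sum.inl)) (w ∘ Sum.inr)) ?_ hX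
  rintro ((a | i) | i)
  · exact definableFun_const L _ (hA₀ a.2)
  · exact Set.DefinableFun.proj L
  · exact Set.DefinableFun.proj L

/-- Stable embeddedness lets one negate a quantifier over `D`: the sections of `X` are uniformly
definable with parameters in `D`. -/
theorem compl [Finite α] (hD : A.Definable₁ L D) (hSE : L[[A]].StablyEmbedded D)
    (htr : ∀ {γ : Type} [Finite γ] {X : Set (γ → M)}, A.Definable L X →
      (∅ : Set D).Definable Lp {v : γ → D | (fun i => (v i : M)) ∈ X})
    {S : Set (α → M)} (hS : DefinableThrough L A D Lp S) : DefinableThrough L A D Lp Sᶜ := by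
  obtain ⟨k, X, Θ, hX, hΘ, rfl⟩ := hS
  obtain ⟨k', Y, hY, hXY⟩ := hSE.exists_definable hX
  -- p says that b codes the section X_v ∩ D^k; q below says that the section coded by b misses Θ,
  -- which concerns D alone.
  let p : (α ⊕ Fin k' → M) → (Fin k → M) → Prop := fun w z => (∀ i, z i ∈ D) →
    (Sum.elim (w ∘ Sum.inl) z ∈ X ↔ Sum.elim (w ∘ Sum.inr) z ∈ Y)
  have hp : A.Definable L {w | ∀ z, p w z} := by
    refine Set.Definable.all ((Set.Definable.forall_coord_mem hD Sum.inr).imp ?_)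
    exact (hX.sumElim_comp (fun i => Sum.inl (Sum.inl i)) Sum.inr).iff
      (hY.sumElim_comp (fun i => Sum.inl (Sum.inr i)) Sum.inr)
  let q : (Fin k' → D) → (Fin k → D) → Prop := fun b z =>
    Sum.elim (fun i => (b i : M)) (fun i => (z i : M)) ∈ Y → z ∉ Θ
  have hq : (∅ : Set D).Definable Lp {b | ∀ z, q b z} := by
    refine Set.Definable.all (Set.Definable.imp ?_ (hΘ.comp Sum.inr).not)
    exact htr (hY.sumElim_comp Sum.inl Sum.inr)
  refine ⟨k', _, _, hp, hq, ?_⟩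
  ext v
  constructor
  · intro hv
    obtain ⟨b, hb⟩ := hXY v
    refine ⟨b, fun z hz => hb fun i => ⟨z i, hz i⟩, fun z hz hzΘ => hv ⟨z, (hb z).2 hz, hzΘ⟩⟩
  · rintro ⟨b, hb, hb'⟩ ⟨z, hz, hzΘ⟩
    exact hb' z ((hb (fun i => z i) fun i => (z i).2).1 hz) hzΘ

end DefinableThrough

variable [Lp.IsRelational] [Lp.Structure M]

/-- Sets definable in a structure on `D` are definable in the expansion of `M` by that structure. -/
theorem definable_lift [L.IsRelational] (hD : A.Definable₁ L D)
    (hrel : ∀ {n : ℕ} (R : Lp.Relations n) (v : Fin n → M),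
      RelMap R v ↔ ∃ h : ∀ i, v i ∈ D, RelMap R fun i => (⟨v i, h i⟩ : D))
    {α : Type*} [Finite α] {Θ : Set (α → D)} (hΘ : (∅ : Set D).Definable Lp Θ) :
    A.Definable (L.sum Lp) {v : α → M | ∃ h : ∀ i, v i ∈ D, (fun i => (⟨v i, h i⟩ : D)) ∈ Θ} := by
  have hD' : A.Definable₁ (L.sum Lp) D := hD.map_expansion LHom.sumInl
  suffices H : ∀ {n : ℕ} (φ : Lp.BoundedFormula α n), A.Definable (L.sum Lp)
      {v : α ⊕ Fin n → M | ∃ h : ∀ i, v i ∈ D,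
        φ.Realize (fun i => (⟨v (Sum.inl i), h _⟩ : D)) fun i => ⟨v (Sum.inr i), h _⟩} by
    obtain ⟨φ, rfl⟩ := empty_definable_iff.1 hΘ
    convert! (H φ).comp (Equiv.sumEmpty α (Fin 0)) using 1
    ext v
    constructor
    · rintro ⟨h, hφ⟩
      exact ⟨fun i => h _, (congrArg (BoundedFormula.Realize φ _) (Subsingleton.elim _ _)).mp hφ⟩
    · rintro ⟨h, hφ⟩
      exact ⟨fun i => h (Sum.inl i),
        (congrArg (BoundedFormula.Realize φ _) (Subsingleton.elim _ _)).mp hφ⟩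
  intro n φ
  induction φ with
  | falsum =>
    convert! definable_empty using 1
    ext v
    simp [BoundedFormula.Realize]
  | equal t₁ t₂ =>
    obtain ⟨i, rfl⟩ := t₁.exists_eq_var
    obtain ⟨j, rfl⟩ := t₂.exists_eq_var
    convert! (Set.Definable.forall_coord_mem hD' id).and
      (Set.DefinableFun.ofPred_eq (Set.DefinableFun.proj (i := i) _)
        (Set.DefinableFun.proj (i := j) _)) using 1
    ext v
    simp only [BoundedFormula.Realize, Term.realize_var, Set.mem_ofPred_eq, id]
    rcases i with i | i <;> rcases j with j | j <;> simp
  | @rel n m R ts =>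
    choose f hf using fun i => (ts i).exists_eq_var
    have hR : A.Definable (L.sum Lp) {v : α ⊕ Fin n → M | RelMap R fun i => v (f i)} := by
      refine Set.Definable.mono (empty_definable_iff.2
        ⟨Relations.formula (L := L.sum Lp) (Sum.inr R) fun i => Term.var (f i), ?_⟩)
          (Set.empty_subset A)
      ext v
      simp only [Set.mem_ofPred_eq]
      rfl
    convert! (Set.Definable.forall_coord_mem hD' id).and hR using 1
    ext v
    simp only [BoundedFormula.Realize, hrel, hf, Term.realize_var, Set.mem_ofPred_eq, id]
    have : ∀ (h : ∀ i, v i ∈ D) (j : α ⊕ Fin n), Sum.elim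
        (fun i => (⟨v (Sum.inl i), h _⟩ : D)) (fun i => ⟨v (Sum.inr i), h _⟩) j = ⟨v j, h j⟩ := by
      intro h j
      rcases j with j | j <;> rfl
    constructor
    · rintro ⟨h, h'⟩
      simp only [this] at h'
      exact ⟨h, fun i => h _, h'⟩
    · rintro ⟨h, _, h'⟩
      refine ⟨h, ?_⟩
      simp only [this]
      exact h'
  | imp φ ψ ihφ ihψ =>
    convert! (Set.Definable.forall_coord_mem hD' id).and (ihφ.imp ihψ) using 1
    ext v
    simp only [BoundedFormula.Realize, Set.mem_ofPred_eq, id]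
    constructor
    · rintro ⟨h, h'⟩
      exact ⟨h, fun ⟨_, h₁⟩ => ⟨h, h' h₁⟩⟩
    · rintro ⟨h, h'⟩
      exact ⟨h, fun h₁ => (h' ⟨h, h₁⟩).2⟩
  | @all n φ ih =>
    -- g separates the last bound variable, whose quantifier is relativized to D.
    let g : α ⊕ Fin (n + 1) → (α ⊕ Fin n) ⊕ Fin 1 :=
      Sum.elim (fun i => Sum.inl (Sum.inl i))
        (Fin.lastCases (Sum.inr 0) fun i => Sum.inl (Sum.inr i))
    let S : Set (α ⊕ Fin (n + 1) → M) := {v | ∃ h : ∀ i, v i ∈ D,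
      φ.Realize (fun i => (⟨v (Sum.inl i), h _⟩ : D)) fun i => ⟨v (Sum.inr i), h _⟩}
    let p : (α ⊕ Fin n → M) → (Fin 1 → M) → Prop := fun v x =>
      x 0 ∈ D → (fun i => Sum.elim v x (g i)) ∈ S
    have hp : A.Definable (L.sum Lp) {v | ∀ x, p v x} := by
      refine Set.Definable.all ((Set.Definable.coord_mem hD' (Sum.inr 0)).imp ?_)
      convert! ih.comp g using 1
      ext w
      simp only [Sum.elim_comp_inl_inr]
      rfl
    convert! (Set.Definable.forall_coord_mem hD' id).and hp using 1
    ext v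
    simp only [BoundedFormula.Realize, Set.mem_ofPred_eq, id]
    have hg : ∀ (h : ∀ i, v i ∈ D) (x : D) (h' : ∀ i, Sum.elim v (fun _ : Fin 1 => (x : M)) (g i) ∈ D),
        (fun i => (⟨Sum.elim v (fun _ : Fin 1 => (x : M)) (g (Sum.inr i)), h' _⟩ : D)) =
          Fin.snoc (fun i => (⟨v (Sum.inr i), h _⟩ : D)) x := by
      intro h x h'
      ext i
      induction i using Fin.lastCases with
      | last => simp [g]
      | cast i => simp [g]
    constructor
    · rintro ⟨h, h'⟩
      refine ⟨h, fun x hx => ?_⟩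
      obtain ⟨x, rfl⟩ : ∃ y, x = fun _ => y := ⟨x 0, by ext i; rw [Subsingleton.elim i 0]⟩
      have h₁ : ∀ i, Sum.elim v (fun _ : Fin 1 => x) (g i) ∈ D := by
        rintro (i | i)
        · exact h (Sum.inl i)
        · induction i using Fin.lastCases with
          | last => simpa [g] using hx
          | cast i => simpa [g] using h (Sum.inr i)
      refine ⟨h₁, ?_⟩
      rw [hg h ⟨x, hx⟩ h₁]
      exact h' ⟨x, hx⟩
    · rintro ⟨h, h'⟩
      refine ⟨h, fun x => ?_⟩
      obtain ⟨h₁, h₂⟩ := h' (fun _ => x) x.2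
      rw [hg h x h₁] at h₂
      exact h₂

theorem DefinableThrough.definable [L.IsRelational] (hD : A.Definable₁ L D)
    (hrel : ∀ {n : ℕ} (R : Lp.Relations n) (v : Fin n → M),
      RelMap R v ↔ ∃ h : ∀ i, v i ∈ D, RelMap R fun i => (⟨v i, h i⟩ : D))
    {α : Type*} [Finite α] {S : Set (α → M)} (hS : DefinableThrough L A D Lp S) :
    A.Definable (L.sum Lp) S := by
  obtain ⟨k, X, Θ, hX, hΘ, rfl⟩ := hS
  let p : (α → M) → (Fin k → M) → Prop := fun v z =>
    Sum.elim v z ∈ X ∧ ∃ h : ∀ i, z i ∈ D, (fun i => (⟨z i, h i⟩ : D)) ∈ Θ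
  have hp : A.Definable (L.sum Lp) {v | ∃ z, p v z} :=
    Set.Definable.ex (((hX.map_expansion LHom.sumInl).sumElim_comp Sum.inl Sum.inr).and
      ((definable_lift hD hrel hΘ).comp Sum.inr))
  convert! hp using 1
  ext v
  constructor
  · rintro ⟨z, h₁, h₂⟩
    exact ⟨fun i => z i, h₁, fun i => (z i).2, h₂⟩
  · rintro ⟨z, h₁, h, h₂⟩
    exact ⟨fun i => ⟨z i, h i⟩, h₁, h₂⟩

/-- Elimination of quantifiers in the expansion, down to quantifiers over `D`. -/
theorem definableThrough_of_definable [L.IsRelational] (hD : A.Definable₁ L D)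
    (hSE : L[[A]].StablyEmbedded D)
    (htr : ∀ {γ : Type} [Finite γ] {X : Set (γ → M)}, A.Definable L X →
      (∅ : Set D).Definable Lp {v : γ → D | (fun i => (v i : M)) ∈ X})
    (hrel : ∀ {n : ℕ} (R : Lp.Relations n) (v : Fin n → M),
      RelMap R v ↔ ∃ h : ∀ i, v i ∈ D, RelMap R fun i => (⟨v i, h i⟩ : D))
    {α : Type u₁} [Finite α] {S : Set (α → M)} (hS : A.Definable (L.sum Lp) S) :
    DefinableThrough L A D Lp S := by
  -- The variables will include a finite set of parameters from M, hence the universe of β.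
  suffices H : ∀ {β : Type (max w u₁)} [Finite β] {n : ℕ}
      (φ : (L.sum Lp).BoundedFormula β n), DefinableThrough L A D Lp
        {v : β ⊕ Fin n → M | φ.Realize (fun i => v (Sum.inl i)) fun i => v (Sum.inr i)} by
    obtain ⟨A₀, hA₀, hS₀⟩ := definable_iff_finitely_definable.1 hS
    obtain ⟨φ, rfl⟩ := definable_iff_exists_formula_sum.1 hS₀
    have h := ((H φ).comp (Equiv.sumEmpty _ (Fin 0))).subst_params hA₀
    convert! h using 1
    ext v
    exact iff_of_eq (congrArg (BoundedFormula.Realize φ _) (Subsingleton.elim _ _))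
  intro β _ n φ
  induction φ with
  | falsum =>
    exact DefinableThrough.of_definable definable_empty
  | equal t₁ t₂ =>
    obtain ⟨i, rfl⟩ := t₁.exists_eq_var
    obtain ⟨j, rfl⟩ := t₂.exists_eq_var
    convert! DefinableThrough.of_definable (Set.DefinableFun.ofPred_eq
      (Set.DefinableFun.proj (i := i) _) (Set.DefinableFun.proj (i := j) _)) using 1
    ext v
    simp only [BoundedFormula.Realize, Term.realize_var, Set.mem_ofPred_eq]
    rcases i with i | i <;> rcases j with j | j <;> simp
  | @rel n m R ts =>
    choose f hf using fun i => (ts i).exists_eq_var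
    have hf' : ∀ (v : β ⊕ Fin n → M) (i : Fin m), (ts i).realize
        (Sum.elim (fun i => v (Sum.inl i)) fun i => v (Sum.inr i)) = v (f i) := by
      intro v i
      rw [hf, Term.realize_var]
      generalize f i = j
      rcases j with j | j <;> rfl
    simp only [BoundedFormula.Realize, hf']
    rcases R with R | R
    · refine DefinableThrough.of_definable (Set.Definable.mono (empty_definable_iff.2
        ⟨R.formula fun i => Term.var (f i), ?_⟩) (Set.empty_subset A))
      ext v
      simp only [Set.mem_ofPred_eq, Formula.realize_rel]
      rfl
    -- A new relation holds only inside D: X says that the arguments equal z, and Θ is the relation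
    -- itself.
    · have hX : A.Definable L {w : (β ⊕ Fin n) ⊕ Fin m → M |
          ∀ i, w (Sum.inl (f i)) = w (Sum.inr i)} :=
        Set.Definable.forall_finite fun i =>
          Set.DefinableFun.ofPred_eq (Set.DefinableFun.proj _) (Set.DefinableFun.proj _)
      have hΘ : (∅ : Set D).Definable Lp {z : Fin m → D | RelMap R z} := by
        refine empty_definable_iff.2 ⟨R.formula fun i => Term.var i, ?_⟩
        ext v
        simp only [Set.mem_ofPred_eq, Formula.realize_rel]
        rfl
      convert! DefinableThrough.of_finite hX hΘ using 1
      ext v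
      refine (hrel R fun i => v (f i)).trans ?_
      constructor
      · rintro ⟨h, h'⟩
        exact ⟨fun i => ⟨v (f i), h i⟩, fun i => rfl, h'⟩
      · rintro ⟨z, h, h'⟩
        have hv : ∀ i, v (f i) = z i := h
        have hD : ∀ i, v (f i) ∈ D := fun i => (hv i).symm ▸ (z i).2
        have hz : (fun i => (⟨v (f i), hD i⟩ : D)) = z := by
          ext i
          exact hv i
        exact ⟨hD, hz.symm ▸ h'⟩
  | imp φ ψ ihφ ihψ =>
    convert! (ihφ.inter (ihψ.compl hD hSE htr)).compl hD hSE htr using 1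
    ext v
    simp [BoundedFormula.Realize]
  | @all n φ ih =>
    let g : β ⊕ Fin (n + 1) → (β ⊕ Fin n) ⊕ Fin 1 :=
      Sum.elim (fun i => Sum.inl (Sum.inl i))
        (Fin.lastCases (Sum.inr 0) fun i => Sum.inl (Sum.inr i))
    convert! (((ih.compl hD hSE htr).comp g).ex).compl hD hSE htr using 1
    ext v
    simp only [BoundedFormula.Realize, Set.mem_ofPred_eq, Set.mem_compl_iff, not_exists, not_not]
    have hg : ∀ x : Fin 1 → M, (fun i => Sum.elim v x (g (Sum.inr i))) =
        Fin.snoc (fun i => v (Sum.inr i)) (x 0) := by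
      intro x
      ext i
      induction i using Fin.lastCases with
      | last => simp [g]
      | cast i => simp [g]
    constructor
    · intro h x
      rw [hg]
      exact h (x 0)
    · intro h x
      have := h fun _ => x
      rw [hg] at this
      exact this

end Expansion

end FirstOrder.Language

/-! ### Transfer of NIP to the expansion. -/

namespace FirstOrder.Language

open Set Structure

open Classical in
/-- The sentence saying that the formula `φ(x; y)` shatters `n` tuples. -/
noncomputable def Formula.shattersSentence {L : Language.{u, v}} {k l : ℕ}
    (φ : L.Formula (Fin k ⊕ Fin l)) (n : ℕ) : L.Sentence :=
  Formula.iExs ((Fin n × Fin k) ⊕ (Set (Fin n) × Fin l))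
    (Formula.iInf fun p : Fin n × Set (Fin n) =>
      let ψ : L.Formula (Empty ⊕ ((Fin n × Fin k) ⊕ (Set (Fin n) × Fin l))) :=
        φ.relabel (Sum.elim (fun i => Sum.inr (Sum.inl (p.1, i)))
          fun j => Sum.inr (Sum.inr (p.2, j)))
      if p.1 ∈ p.2 then ψ else ψ.not)

theorem Formula.realize_shattersSentence {L : Language.{u, v}} {M : Type w} [L.Structure M]
    {k l : ℕ} (φ : L.Formula (Fin k ⊕ Fin l)) (n : ℕ) :
    M ⊨ φ.shattersSentence n ↔
      ShattersFamily (fun (a : Fin k → M) (b : Fin l → M) => φ.Realize (Sum.elim a b)) n := by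
  have key : ∀ (c : (Fin n × Fin k) ⊕ (Set (Fin n) × Fin l) → M) (i : Fin n) (S : Set (Fin n)),
      Sum.elim (default : Empty → M) c ∘ Sum.elim (fun j => Sum.inr (Sum.inl (i, j)))
        (fun j => Sum.inr (Sum.inr (S, j))) =
      Sum.elim (fun j : Fin k => c (Sum.inl (i, j))) fun j : Fin l => c (Sum.inr (S, j)) := by
    intro c i S
    ext j
    rcases j with j | j <;> rfl
  have key' : ∀ (c : (Fin n × Fin k) ⊕ (Set (Fin n) × Fin l) → M) (i : Fin n) (S : Set (Fin n))
      (ψ : L.Formula (Empty ⊕ ((Fin n × Fin k) ⊕ (Set (Fin n) × Fin l)))) [Decidable (i ∈ S)],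
      (if i ∈ S then ψ else ψ.not).Realize (Sum.elim default c) ↔
        (ψ.Realize (Sum.elim default c) ↔ i ∈ S) := by
    intro c i S ψ _
    split_ifs with h <;> simp [h, Formula.realize_not]
  simp only [Formula.shattersSentence, Sentence.Realize, Formula.realize_iExs,
    Formula.realize_iInf, key', Formula.realize_relabel, key, Prod.forall]
  constructor
  · rintro ⟨c, hc⟩
    exact ⟨_, _, hc⟩
  · rintro ⟨a, b, hab⟩
    exact ⟨Sum.elim (fun x => a x.1 x.2) fun x => b x.1 x.2, hab⟩

/-- `Theory.IsNIP` tests models in one universe only. M has an elementarily equivalent model there,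
and shattering n tuples is expressed by a sentence. -/
theorem Theory.IsNIP.isNIPStructure {L : Language.{u, v}} {T : L.Theory} (hT : T.IsNIP)
    {M : Type w} [L.Structure M] [Nonempty M] (hM : M ⊨ T) : L.IsNIPStructure M := by
  obtain ⟨N⟩ := completeTheory.isSatisfiable L M
  have hN : ∀ σ : L.Sentence, M ⊨ σ → N ⊨ σ := fun σ hσ => N.is_model.realize_of_mem σ hσ
  have hNT : N ⊨ T := ⟨fun σ hσ => hN σ (hM.realize_of_mem σ hσ)⟩
  intro k l φ
  obtain ⟨n, hn⟩ := hT (Theory.ModelType.of T N) k l φ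
  exact ⟨n, fun h => hn ((φ.realize_shattersSentence n).1
    (hN _ ((φ.realize_shattersSentence n).2 h)))⟩

theorem IsNIPStructure.isNIPRel {L : Language.{u, v}} {M : Type w} [L.Structure M]
    (hM : L.IsNIPStructure M) {A : Set M} {α β : Type*} [Finite α] [Finite β]
    {S : Set (α ⊕ β → M)} (hS : A.Definable L S) :
    IsNIPRel fun (a : α → M) (b : β → M) => Sum.elim a b ∈ S := by
  obtain ⟨A₀, -, hS₀⟩ := definable_iff_finitely_definable.1 hS
  obtain ⟨φ, rfl⟩ := definable_iff_exists_formula_sum.1 hS₀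
  obtain ⟨k, ⟨e⟩⟩ := Finite.exists_equiv_fin α
  obtain ⟨l, ⟨f⟩⟩ := Finite.exists_equiv_fin ((A₀ : Set M) ⊕ β)
  -- The parameters join the second tuple, where they are the same for every S.
  let g : (A₀ : Set M) ⊕ (α ⊕ β) → Fin k ⊕ Fin l :=
    Sum.elim (fun a => Sum.inr (f (Sum.inl a)))
      (Sum.elim (fun i => Sum.inl (e i)) fun j => Sum.inr (f (Sum.inr j)))
  obtain ⟨n, hn⟩ := hM k l (φ.relabel g)
  refine ⟨n, fun ⟨a, b, hab⟩ => hn ⟨fun i => a i ∘ e.symm,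
    fun S => Sum.elim (fun x : (A₀ : Set M) => (x : M)) (b S) ∘ f.symm, fun i S => ?_⟩⟩
  rw [← hab i S, Formula.realize_relabel]
  refine iff_of_eq (congrArg φ.Realize ?_)
  ext x
  rcases x with x | x | x <;> simp [g]

section Expansion

variable {L : Language.{u, v}} {M : Type w} [L.Structure M] {A D : Set M}
variable {Lp : Language.{u', v'}} [Lp.Structure D]

theorem DefinableThrough.trace
    (htr : ∀ {γ : Type} [Finite γ] {X : Set (γ → M)}, A.Definable L X →
      (∅ : Set D).Definable Lp {v : γ → D | (fun i => (v i : M)) ∈ X})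
    {α : Type} [Finite α] {S : Set (α → M)} (hS : DefinableThrough L A D Lp S) :
    (∅ : Set D).Definable Lp {v : α → D | (fun i => (v i : M)) ∈ S} := by
  obtain ⟨k, X, Θ, hX, hΘ, rfl⟩ := hS
  let p : (α → D) → (Fin k → D) → Prop := fun v z =>
    Sum.elim (fun i => (v i : M)) (fun i => (z i : M)) ∈ X ∧ z ∈ Θ
  have hp : (∅ : Set D).Definable Lp {v | ∃ z, p v z} := by
    refine Set.Definable.ex (Set.Definable.and ?_ (hΘ.comp Sum.inr))
    exact htr (hX.sumElim_comp Sum.inl Sum.inr)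
  exact hp

/-- The sections of a set definable through `D` are uniformly definable, again through `D`, with
parameters from `D`. -/
theorem DefinableThrough.exists_uniform (hSE : L[[A]].StablyEmbedded D)
    {α β : Type} [Finite α] [Finite β] {S : Set (α ⊕ β → M)} (hS : DefinableThrough L A D Lp S) :
    ∃ (k : ℕ) (Y : Set (Fin k ⊕ β → M)), DefinableThrough L A D Lp Y ∧ ∀ a : α → M,
      ∃ b : Fin k → D, ∀ d : β → D, Sum.elim a (fun i => (d i : M)) ∈ S ↔
        Sum.elim (fun i => (b i : M)) (fun i => (d i : M)) ∈ Y := by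
  obtain ⟨k, X, Θ, hX, hΘ, rfl⟩ := hS
  -- The witnesses z lie in D too, so they are grouped with d before stable embeddedness is applied.
  have hX' : A.Definable L {v : α ⊕ (β ⊕ Fin k) → M |
      (fun i => v (Equiv.sumAssoc α β (Fin k) i)) ∈ X} := hX.comp _
  obtain ⟨m, Y, hY, hXY⟩ := hSE.exists_definable hX'
  refine ⟨m, _, ⟨k, {v | (fun i => v ((Equiv.sumAssoc (Fin m) β (Fin k)).symm i)) ∈ Y}, Θ,
    hY.comp _, hΘ, rfl⟩, fun a => ?_⟩
  obtain ⟨b, hb⟩ := hXY a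
  refine ⟨b, fun d => exists_congr fun z => and_congr_left fun _ => ?_⟩
  convert! hb (Sum.elim d z) using 1
  · refine iff_of_eq (congrArg (· ∈ X) ?_)
    ext i
    rcases i with (i | i) | i <;> rfl
  · refine iff_of_eq (congrArg (· ∈ Y) ?_)
    ext i
    rcases i with i | i | i <;> rfl

/-- If `M` is NIP and `D` carries an NIP structure expanding the induced one, then the
relations definable through `D` are NIP. -/
theorem DefinableThrough.isNIPRel [L.IsRelational] [Lp.IsRelational] [Lp.Structure M]
    (hD : A.Definable₁ L D)
    (hSE : L[[A]].StablyEmbedded D)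
    (htr : ∀ {γ : Type} [Finite γ] {X : Set (γ → M)}, A.Definable L X →
      (∅ : Set D).Definable Lp {v : γ → D | (fun i => (v i : M)) ∈ X})
    (hrel : ∀ {n : ℕ} (R : Lp.Relations n) (v : Fin n → M),
      RelMap R v ↔ ∃ h : ∀ i, v i ∈ D, RelMap R fun i => (⟨v i, h i⟩ : D))
    (hM : L.IsNIPStructure M) (hD' : Lp.IsNIPStructure D)
    {α β : Type} [Finite α] [Finite β] {S : Set (α ⊕ β → M)} (hS : DefinableThrough L A D Lp S) :
    IsNIPRel fun (a : α → M) (b : β → M) => Sum.elim a b ∈ S := by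
  have hSdef := hS.definable hD hrel
  obtain ⟨k, X, Θ, hX, hΘ, rfl⟩ := hS
  set S := {v : α ⊕ β → M | ∃ z : Fin k → D, Sum.elim v (fun i => (z i : M)) ∈ X ∧ z ∈ Θ} with hS
  obtain ⟨m, Y, hY, hXY⟩ := hSE.exists_definable hX
  -- E compares the sections X_{xy} and X_{xy'} on D^k; C says that w codes X_{xy} there. Both are
  -- definable in M itself.
  let E : (α → M) → (β → M) → (β → M) → Prop := fun x y y' => ∀ z : Fin k → M, (∀ i, z i ∈ D) →
    (Sum.elim (Sum.elim x y) z ∈ X ↔ Sum.elim (Sum.elim x y') z ∈ X)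
  let C : (α → M) → (β → M) → (Fin m → M) → Prop := fun x y w => ∀ z : Fin k → M,
    (∀ i, z i ∈ D) → (Sum.elim (Sum.elim x y) z ∈ X ↔ Sum.elim w z ∈ Y)
  have hXcomp : ∀ {γ : Type} (f : α → γ) (g : β → γ) (h : Fin k → γ), A.Definable L
      {v : γ → M | Sum.elim (Sum.elim (fun i => v (f i)) fun i => v (g i)) (fun i => v (h i)) ∈ X} := by
    intro γ f g h
    convert! hX.comp (Sum.elim (Sum.elim f g) h) using 1
    ext v
    refine iff_of_eq (congrArg (· ∈ X) ?_)
    ext i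
    rcases i with (i | i) | i <;> rfl
  have hEdef : A.Definable L {v : α ⊕ (β ⊕ β) → M |
      E (fun i => v (Sum.inl i)) (fun i => v (Sum.inr (Sum.inl i)))
        fun i => v (Sum.inr (Sum.inr i))} := by
    refine Set.Definable.all ((Set.Definable.forall_coord_mem hD Sum.inr).imp (Set.Definable.iff ?_ ?_))
    · exact hXcomp _ _ _
    · exact hXcomp _ _ _
  have hCdef : ∀ {γ : Type} (f : α → γ) (g : β → γ) (h : Fin m → γ), A.Definable L
      {v : γ → M | C (fun i => v (f i)) (fun i => v (g i)) fun i => v (h i)} := by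
    intro γ f g h
    refine Set.Definable.all ((Set.Definable.forall_coord_mem hD Sum.inr).imp (Set.Definable.iff ?_ ?_))
    · exact hXcomp (fun i => Sum.inl (f i)) (fun i => Sum.inl (g i)) Sum.inr
    · exact hY.sumElim_comp (fun i => Sum.inl (h i)) Sum.inr
  refine isNIPRel_of_code (W := Fin m → D) (E := E) (Code := fun x y w => C x y fun i => w i)
    ?_ ?_ ?_ ?_ ?_
  · intro x y y' h
    exact exists_congr fun z => and_congr_left fun _ => h _ fun i => (z i).2
  · intro x y
    obtain ⟨b, hb⟩ := hXY (Sum.elim x y)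
    exact ⟨b, fun z hz => hb fun i => ⟨z i, hz i⟩⟩
  · intro x y y' w h
    exact forall₂_congr fun z hz => by rw [h z hz]; exact iff_comm
  · obtain ⟨n, hn⟩ := hM.isNIPRel hEdef
    exact ⟨n, fun ⟨a, b, hab⟩ => hn ⟨a, fun S => Sum.elim (b S).1 (b S).2, hab⟩⟩
  · intro q
    -- xs and x are variables of p, so one relation Z on D serves all xs: (xs, x) is replaced by a
    -- tuple c of D while the codes already lie in D. The bound n is therefore independent of xs.
    let p : (((Fin q × α) ⊕ α) ⊕ (Fin q × Fin m) → M) → (β → M) → Prop := fun v y =>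
      (∀ j, C (fun i => v (Sum.inl (Sum.inl (j, i)))) y fun i => v (Sum.inr (j, i))) ∧
        Sum.elim (fun i => v (Sum.inl (Sum.inr i))) y ∈ S
    have hp : A.Definable (L.sum Lp) {v | ∃ y, p v y} := by
      refine Set.Definable.ex (Set.Definable.and (Set.Definable.forall_finite fun j => ?_) ?_)
      · exact (hCdef (fun i => Sum.inl (Sum.inl (Sum.inl (j, i)))) Sum.inr
          fun i => Sum.inl (Sum.inr (j, i))).map_expansion LHom.sumInl
      · exact hSdef.sumElim_comp (fun i => Sum.inl (Sum.inl (Sum.inr i))) Sum.inr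
    obtain ⟨r, Z, hZ, hpZ⟩ :=
      (definableThrough_of_definable hD hSE htr hrel hp).exists_uniform hSE
    obtain ⟨n, hn⟩ := hD'.isNIPRel (hZ.trace htr)
    refine ⟨n, fun xs ⟨a, b, hab⟩ => hn ?_⟩
    choose c hc using fun x : α → M => hpZ (Sum.elim (fun i => xs i.1 i.2) x)
    refine ⟨fun i => c (a i), fun S i => b S i.1 i.2, fun i S => ?_⟩
    rw [← hab i S]
    have h := (hc (a i) fun i => b S i.1 i.2).symm
    refine Iff.trans (iff_of_eq (congrArg (· ∈ Z) ?_)) h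
    ext j
    rcases j with j | j <;> rfl

end Expansion

end FirstOrder.Language

/-! ### The three conclusions. -/

theorem proposition2p5
    {L : FirstOrder.Language.{u, v}} [L.IsRelational]
    (T : L.Theory) (hT : T.IsNIP)
    {M : Type w} [L.Structure M] [Nonempty M] (hM : M ⊨ T)
    (A D : Set M) (hD : A.Definable₁ L D)
    (hSE : L[[A]].StablyEmbedded D)
    {Lp : FirstOrder.Language.{u', v'}} [Lp.IsRelational] [Lp.Structure D]
    (ι : L[[A]].inducedLanguage →ᴸ Lp) (hι : ι.IsExpansionOn D) :
    letI : Lp.Structure M := FirstOrder.Language.extendStructure Lp D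
    (L.sum Lp)[[A]].StablyEmbedded D ∧
    (∀ (n : ℕ) (S : Set (Fin n → D)),
      (∃ X : Set (Fin n → M), A.Definable (L.sum Lp) X ∧
        S = {v | (fun i => (v i : M)) ∈ X}) ↔ (∅ : Set D).Definable Lp S) ∧
    (Lp.IsNIPStructure D → (L.sum Lp).IsNIPStructure M) := by
  let : Lp.Structure M := FirstOrder.Language.extendStructure Lp D
  have hrel : ∀ {n : ℕ} (R : Lp.Relations n) (v : Fin n → M),
      FirstOrder.Language.Structure.RelMap R v ↔
        ∃ h : ∀ i, v i ∈ D, FirstOrder.Language.Structure.RelMap R fun i => (⟨v i, h i⟩ : D) :=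
    fun R v => Iff.rfl
  have htr : ∀ {γ : Type} [Finite γ] {X : Set (γ → M)}, A.Definable L X →
      (∅ : Set D).Definable Lp {v : γ → D | (fun i => (v i : M)) ∈ X} :=
    fun hX => FirstOrder.Language.definable_trace ι hι hX
  have hQE : ∀ {γ : Type} [Finite γ] {X : Set (γ → M)}, A.Definable (L.sum Lp) X →
      FirstOrder.Language.DefinableThrough L A D Lp X :=
    fun hX => FirstOrder.Language.definableThrough_of_definable hD hSE htr hrel hX
  refine ⟨FirstOrder.Language.stablyEmbedded_of_definable fun m n X hX => ?_, fun n S => ⟨?_, ?_⟩,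
    fun hD' k l φ => ?_⟩
  · obtain ⟨k, Y, hY, h⟩ := (hQE hX).exists_uniform hSE
    exact ⟨k, Y, hY.definable hD hrel, h⟩
  · rintro ⟨X, hX, rfl⟩
    exact (hQE hX).trace htr
  · intro hS
    refine ⟨_, FirstOrder.Language.definable_lift hD hrel hS, ?_⟩
    ext v
    exact ⟨fun h => ⟨fun i => (v i).2, h⟩, fun ⟨_, h⟩ => h⟩
  · have hφ : A.Definable (L.sum Lp) {v | φ.Realize v} :=
      Set.Definable.mono (Set.empty_definable_iff.2 ⟨φ, rfl⟩) (Set.empty_subset A)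
    exact (hQE hφ).isNIPRel hD hSE htr hrel (hT.isNIPStructure hM) hD'
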